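/- \textbf{Theorem (Uniform spectral amplification by spectral multiplication).} \emph{Conventions.} $\|\cdot\|$ is the spectral norm. A matrix $H\in\mathbb C^{n\times n}$ is encoded in standard-form-$(H,\alpha,U,d)$, with normalization $\alpha>0$, $\alpha\ge\|H\|$, if $U\in\mathbb C^{dn\times dn}$ is a unitary on the tensor product of an ancilla register $\mathbb C^d$ and the system $\mathbb C^n$ such that $(\langle 0|\otimes I)\,U\,(|0\rangle\otimes I)=H/\alpha$, where $|0\rangle$ is a fixed computational basis state of the ancilla (for an ancilla composed of several registers, all of them in their state $|0\rangle$). Controlled-$U$ is $|0\rangle\langle 0|\otimes I+|1\rangle\langle 1|\otimes U$, where the control is one of the additional qubits. A $Q$-query circuit on $\mathbb C^2\otimes\mathbb C^2\otimes\mathbb C^d\otimes\mathbb C^n$ is a finite sequence of unitaries that do not depend on $U$ or $H$, interleaved with $Q$ uses in total of controlled-$U$ and its inverse. \emph{Statement.} There are universal constants $c,C>0$ such that the following holds for all $n$, all $d\ge 1$, all real $0<\Lambda\le\alpha$ and all $0<\varepsilon\le c\,\Lambda/\alpha$. There is a query circuit, depending only on $n,d,\alpha,\Lambda,\varepsilon$,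 that makes at most $C\,\frac{\alpha}{\Lambda}\log(1/\varepsilon)$ queries to controlled-$U$ and its inverse, and such that for every Hermitian $H$ with $\|H\|\le\Lambda$ and every $U$ encoding $H$ in standard-form-$(H,\alpha,U,d)$, the unitary $V$ that the circuit implements with oracle $U$ encodes some matrix $H_{\mathrm{amp}}$ in standard-form-$(H_{\mathrm{amp}},2\Lambda,V,4d)$ with \[ \frac{1}{2\Lambda}\,\|H_{\mathrm{amp}}-H\|\le\varepsilon . \] -/

import Mathlib

-- `‖H‖` on complex matrices is the spectral norm (the operator norm for the Euclidean norm).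
open scoped Matrix.Norms.L2Operator

namespace SpectralAmp

/-- Standard-form-`(H, α, U, d)`. The joint space of ancilla and system has the computational
basis `a × s`; the ancilla register has dimension `d`, its basis state `|0⟩` is the index `0 : a`,
and `(⟨0| ⊗ I) U (|0⟩ ⊗ I) = H / α` with `U` unitary and normalization `α ≥ ‖H‖`. -/
structure IsStandardForm {a s : Type} [Fintype a] [DecidableEq a] [Zero a]
    [Fintype s] [DecidableEq s]
    (H : Matrix s s ℂ) (α : ℝ) (U : Matrix (a × s) (a × s) ℂ) (d : ℕ) : Prop where
  card_ancilla : Fintype.card a = d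
  normalization_pos : 0 < α
  norm_le : ‖H‖ ≤ α
  unitary : U ∈ Matrix.unitaryGroup (a × s) ℂ
  block : U.submatrix (fun i => ((0 : a), i)) (fun j => ((0 : a), j)) = (1 / (α : ℂ)) • H

/-- The ancilla register of the output: two qubits `c`, `b` together with the ancilla register `a`
of the input, so of dimension `4 d` when `a` has dimension `d`. -/
abbrev Anc (a : Type) : Type := Fin 2 × Fin 2 × a

/-- Controlled-`U`, i.e. `I_c ⊗ (|0⟩⟨0|_b ⊗ I + |1⟩⟨1|_b ⊗ U)`: the qubit `b` is the control and
`U` acts on the input's ancilla register and the system. -/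
def controlled {a s : Type} [DecidableEq a] [DecidableEq s] (U : Matrix (a × s) (a × s) ℂ) :
    Matrix (Anc a × s) (Anc a × s) ℂ :=
  Matrix.of fun p q =>
    if p.1.1 = q.1.1 ∧ p.1.2.1 = q.1.2.1 then
      (if p.1.2.1 = 1 then U else 1) (p.1.2.2, p.2) (q.1.2.2, q.2)
    else 0

/-- One step of a query circuit on the basis `Anc a × s`: a fixed unitary that does not depend on
the oracle, a query to controlled-`U`, or a query to its inverse. -/
inductive Step (a s : Type) [Fintype a] [DecidableEq a] [Fintype s] [DecidableEq s] : Type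
  | gate (W : Matrix.unitaryGroup (Anc a × s) ℂ) : Step a s
  | query : Step a s
  | queryInv : Step a s

section
variable {a s : Type} [Fintype a] [DecidableEq a] [Fintype s] [DecidableEq s]

/-- The operator that a step performs when the oracle is `U`. -/
def Step.eval (U : Matrix (a × s) (a × s) ℂ) : Step a s → Matrix (Anc a × s) (Anc a × s) ℂ
  | .gate W => (W : Matrix (Anc a × s) (Anc a × s) ℂ)
  | .query => controlled U
  | .queryInv => (controlled U).conjTranspose

/-- The number of queries made by a step. -/
def Step.cost : Step a s → ℕ
  | .gate _ => 0
  | .query => 1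
  | .queryInv => 1

end

/-- A query circuit: a list of steps, executed from left to right. -/
abbrev Circuit (a s : Type) [Fintype a] [DecidableEq a] [Fintype s] [DecidableEq s] : Type :=
  List (Step a s)

section
variable {a s : Type} [Fintype a] [DecidableEq a] [Fintype s] [DecidableEq s]

/-- The operator implemented by a circuit with oracle `U`. -/
def Circuit.eval (U : Matrix (a × s) (a × s) ℂ) :
    Circuit a s → Matrix (Anc a × s) (Anc a × s) ℂ
  | [] => 1
  | g :: gs => Circuit.eval U gs * g.eval U

/-- The number of queries to controlled-`U` and its inverse made by a circuit. -/
def Circuit.queries (circ : Circuit a s) : ℕ := (circ.map Step.cost).sum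

end

end SpectralAmp

namespace SpectralAmp

set_option linter.unusedSectionVars false

/-! ### Polynomial approximation: a low-degree bump and the amplifying odd polynomial. -/

section Approximation
open Polynomial Polynomial.Chebyshev

/-! Put `δ = Λ / α`. The block of `U` is `H / α`, whose eigenvalues `t` lie in `[-δ, δ]`, and the
target `H / (2Λ)` has eigenvalues `t / (2δ)`. It therefore suffices to find an odd real polynomial
`P`, bounded by `1` on `[-1, 1]` and `ε`-close to `t / (2δ)` on `[-δ, δ]`, of degree `O(δ⁻¹ log
(1/ε))`, and to implement `P (H / α)` with as many queries as a fixed degree bound of that order.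

The polynomial (`exists_amplifier`) is `x / (2δ) * ρ (x²)`. A squared Chebyshev polynomial of degree
`O(1/δ)` separates `|x| ≤ δ` from `|x| ≥ √3 δ` by a constant factor. Read as a success probability
and passed through a binomial tail with `O(log (1/ε))` trials, this gap becomes a bump `ρ` with
error `ε` (`exists_bump`). The normalization `2Λ` instead of `Λ` leaves room for the transition
zone, since `√3 < 2`.

The implementation is quantum signal processing. With `t = Re w` and `|w| = 1`, `P t` is, up to a
power of `w`, a polynomial `F` in `w²` with `|F| < 1` on the circle. Fejér–Riesz supplies `G` with
`|F|² + |G|² = 1` (`exists_complement`), and the pair factors into rotations alternating with `diag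
(w, w⁻¹)` (`exists_process`). On a joint eigenvector of the block and its adjoint, alternating `U`
and `U†` preserves a two-dimensional pattern on which, after sign corrections, a query acts as a
rotation with eigenvalues `w` and `w⁻¹` (`bodyCircuit_mulVec`). Both eigenvalues yield the same `P
t`, as it depends only on `Re w`. As `H` is Hermitian, an eigenbasis reduces the norm bounds to
scalar ones. -/

theorem nat_mul_sinh_le (M : ℕ) {x : ℝ} (hx : 0 ≤ x) :
    (M : ℝ) * Real.sinh x ≤ Real.sinh (M * x) := by
  induction M with
  | zero => simp
  | succ k ih =>
    have h1 : Real.sinh ((k : ℝ) * x + x) = _ := Real.sinh_add _ _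
    have hs : 0 ≤ Real.sinh x := Real.sinh_nonneg_iff.2 hx
    have hk : 0 ≤ Real.sinh (k * x) := Real.sinh_nonneg_iff.2 (by positivity)
    have := Real.one_le_cosh x
    have := Real.one_le_cosh (k * x)
    push_cast
    rw [add_mul (k : ℝ) 1 x, one_mul, h1]
    nlinarith

theorem cosh_eq_one_add (x : ℝ) : Real.cosh x = 1 + 2 * Real.sinh (x / 2) ^ 2 := by
  have h := Real.cosh_two_mul (x / 2)
  rw [mul_div_cancel₀ x two_ne_zero, Real.cosh_sq] at h
  linarith

/-- With `y = cosh v`, the half-angle formula `cosh v = 1 + 2 sinh² (v/2)` reduces this to `M sinh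
(v/2) ≤ sinh (M v/2)`. This quadratic growth in `M` makes degree `1/δ` suffice to detect a
displacement of order `δ²`. -/
theorem one_add_sq_mul_le_eval_T (M : ℕ) {y : ℝ} (hy : 1 ≤ y) :
    1 + (M : ℝ) ^ 2 * (y - 1) ≤ (T ℝ M).eval y := by
  have hv := Real.arcosh_nonneg hy
  rw [← Real.cosh_arcosh hy, T_real_cosh]
  set v := Real.arcosh y
  rw [cosh_eq_one_add v, cosh_eq_one_add ((M : ℤ) * v)]
  have h := nat_mul_sinh_le M (x := v / 2) (by positivity)
  have h0 : 0 ≤ Real.sinh (v / 2) := Real.sinh_nonneg_iff.2 (by positivity)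
  have h2 : ((M : ℝ) * Real.sinh (v / 2)) ^ 2 ≤ Real.sinh (M * (v / 2)) ^ 2 := by gcongr
  rw [mul_pow] at h2
  push_cast
  rw [mul_div_assoc]
  linarith

theorem eval_T_le_eval_T (M : ℕ) {x y : ℝ} (hx : 1 ≤ x) (hxy : x ≤ y) :
    (T ℝ M).eval x ≤ (T ℝ M).eval y := by
  have hy := hx.trans hxy
  have h : Real.arcosh x ≤ Real.arcosh y :=
    (Real.arcosh_le_arcosh (by linarith) (by linarith)).2 hxy
  have h0 := Real.arcosh_nonneg hx
  have h1 := Real.arcosh_nonneg hy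
  rw [← Real.cosh_arcosh hx, ← Real.cosh_arcosh hy, T_real_cosh, T_real_cosh, Real.cosh_le_cosh]
  push_cast
  rw [abs_of_nonneg (by positivity), abs_of_nonneg (by positivity)]
  gcongr

theorem abs_eval_T_le (M : ℕ) {x y : ℝ} (hx : 0 ≤ x) (hxy : x ≤ y) (hy : 1 ≤ y) :
    |(T ℝ M).eval x| ≤ (T ℝ M).eval y := by
  rcases le_total x 1 with h | h
  · exact (abs_eval_T_real_le_one M (by rwa [abs_of_nonneg hx])).trans (one_le_eval_T_real M hy)
  · rw [abs_of_nonneg (zero_le_one.trans (one_le_eval_T_real M h))]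
    exact eval_T_le_eval_T M h hxy

/-- The bound is independent of `δ`, so the number of trials in `exists_bump` depends on `ε` alone.
If `cosh v = 1 + 3δ²`, then `v ≤ √6 δ ≤ 5/2 δ`, hence `M v ≤ 5`. -/
theorem eval_T_le_exp_five (M : ℕ) {δ : ℝ} (hδ : 0 < δ) (hM : M * δ ≤ 2) :
    (T ℝ M).eval (1 + 3 * δ ^ 2) ≤ Real.exp 5 := by
  have hy : (1 : ℝ) ≤ 1 + 3 * δ ^ 2 := by nlinarith
  have hv := Real.arcosh_nonneg hy
  have hc := Real.cosh_arcosh hy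
  rw [← hc, T_real_cosh]
  set v := Real.arcosh (1 + 3 * δ ^ 2)
  rw [cosh_eq_one_add] at hc
  have hs : v / 2 ≤ Real.sinh (v / 2) := Real.self_le_sinh_iff.2 (by positivity)
  have hv2 : v ≤ 5 / 2 * δ := by
    have : (v / 2) ^ 2 ≤ Real.sinh (v / 2) ^ 2 := by gcongr
    nlinarith
  have h5 : (M : ℝ) * v ≤ 5 := by
    calc (M : ℝ) * v ≤ M * (5 / 2 * δ) := by gcongr
      _ ≤ 5 := by linarith
  have h0 : 0 ≤ (M : ℝ) * v := by positivity
  calc Real.cosh ((M : ℤ) * v) = Real.cosh (M * v) := by push_cast; rfl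
    _ ≤ Real.exp (M * v) := by
      rw [← Real.cosh_add_sinh]; linarith [Real.sinh_nonneg_iff.2 h0]
    _ ≤ Real.exp 5 := Real.exp_le_exp.2 h5

/-- The probability that a binomial variable with `m` trials of success probability `q` is at
least `t`. -/
noncomputable def binomialTail (m : ℕ) (t : ℝ) (q : ℝ) : ℝ :=
  ∑ k ∈ Finset.range (m + 1) with t ≤ ((k : ℕ) : ℝ), q ^ k * (1 - q) ^ (m - k) * (m.choose k : ℝ)

theorem sum_binomial (m : ℕ) (q s : ℝ) :
    ∑ k ∈ Finset.range (m + 1), (q * s) ^ k * (1 - q) ^ (m - k) * (m.choose k : ℝ)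
      = (1 + q * (s - 1)) ^ m := by
  rw [← add_pow]; ring_nf

theorem binomialTail_add (m : ℕ) (t q : ℝ) :
    binomialTail m t q +
      ∑ k ∈ Finset.range (m + 1) with ¬ t ≤ ((k : ℕ) : ℝ), q ^ k * (1 - q) ^ (m - k) * (m.choose k : ℝ)
      = 1 := by
  have h := sum_binomial m q 1
  rw [← Finset.sum_filter_add_sum_filter_not _ (fun k : ℕ => t ≤ (k : ℝ))] at h
  simpa [binomialTail] using h

theorem binomial_term_nonneg {q : ℝ} (h0 : 0 ≤ q) (h1 : q ≤ 1) (m k : ℕ) :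
    0 ≤ q ^ k * (1 - q) ^ (m - k) * (m.choose k : ℝ) := by
  have : 0 ≤ 1 - q := by linarith
  positivity

theorem binomialTail_nonneg (m : ℕ) (t : ℝ) {q : ℝ} (h0 : 0 ≤ q) (h1 : q ≤ 1) :
    0 ≤ binomialTail m t q :=
  Finset.sum_nonneg fun k _ => binomial_term_nonneg h0 h1 m k

theorem binomialTail_le_one (m : ℕ) (t : ℝ) {q : ℝ} (h0 : 0 ≤ q) (h1 : q ≤ 1) :
    binomialTail m t q ≤ 1 := by
  have := binomialTail_add m t q
  have : 0 ≤ ∑ k ∈ Finset.range (m + 1) with ¬ t ≤ ((k : ℕ) : ℝ),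
      q ^ k * (1 - q) ^ (m - k) * (m.choose k : ℝ) :=
    Finset.sum_nonneg fun k _ => binomial_term_nonneg h0 h1 m k
  linarith

/-- Chernoff's bound: each retained term is weighted by `exp (u k - u t) ≥ 1`, and the full weighted
sum is the binomial moment generating function. The sign of `u` selects the upper or the lower tail.
-/
theorem sum_filter_binomial_le (m : ℕ) (p : ℕ → Prop) [DecidablePred p] {t q u : ℝ}
    (h0 : 0 ≤ q) (h1 : q ≤ 1) (hp : ∀ k, p k → u * t ≤ u * k) :
    ∑ k ∈ Finset.range (m + 1) with p k, q ^ k * (1 - q) ^ (m - k) * (m.choose k : ℝ)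
      ≤ Real.exp (m * (q * (Real.exp u - 1)) - u * t) := by
  have key : ∑ k ∈ Finset.range (m + 1) with p k, q ^ k * (1 - q) ^ (m - k) * (m.choose k : ℝ)
      ≤ ∑ k ∈ Finset.range (m + 1), Real.exp (-(u * t)) *
          ((q * Real.exp u) ^ k * (1 - q) ^ (m - k) * (m.choose k : ℝ)) := by
    rw [Finset.sum_filter]
    refine Finset.sum_le_sum fun k _ => ?_
    have hn := binomial_term_nonneg h0 h1 m k
    have he : Real.exp (-(u * t)) * ((q * Real.exp u) ^ k * (1 - q) ^ (m - k) * (m.choose k : ℝ))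
        = Real.exp (u * k - u * t) * (q ^ k * (1 - q) ^ (m - k) * (m.choose k : ℝ)) := by
      rw [mul_pow, ← Real.exp_nat_mul, sub_eq_add_neg (u * k), Real.exp_add, mul_comm u k]
      ring
    rw [he]
    split_ifs with h
    · exact le_mul_of_one_le_left hn (Real.one_le_exp (by linarith [hp k h]))
    · positivity
  refine key.trans ?_
  rw [← Finset.mul_sum, sum_binomial, sub_eq_neg_add ((m : ℝ) * _), Real.exp_add, Real.exp_nat_mul]
  have : 1 + q * (Real.exp u - 1) ≤ Real.exp (q * (Real.exp u - 1)) := by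
    linarith [Real.add_one_le_exp (q * (Real.exp u - 1))]
  have h3 : 0 ≤ 1 + q * (Real.exp u - 1) := by nlinarith [Real.exp_pos u]
  gcongr

/-- The threshold `3 a m` is three times the largest possible mean `a m`. With `u = log 2` the
exponent is at most `a m - 3 a m log 2`, and `log 2 > 2/3`. -/
theorem binomialTail_le_exp (m : ℕ) {a q : ℝ} (h0 : 0 ≤ q) (h1 : q ≤ 1) (hqa : q ≤ a) :
    binomialTail m (3 * a * m) q ≤ Real.exp (-(a * m)) := by
  have hlog : 2 / 3 < Real.log 2 := by linarith [Real.log_two_gt_d9]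
  refine (sum_filter_binomial_le m (fun k : ℕ => 3 * a * m ≤ (k : ℝ)) (u := Real.log 2)
    (t := 3 * a * m) h0 h1 fun k hk => mul_le_mul_of_nonneg_left hk (by linarith)).trans ?_
  rw [Real.exp_log two_pos]
  apply Real.exp_le_exp.2
  have hm : (0 : ℝ) ≤ m := by positivity
  have h2 : m * q ≤ m * a := by gcongr
  have h3 : 0 ≤ a * m := mul_nonneg (h0.trans hqa) hm
  nlinarith

/-- The mean is now at least three times the threshold. With `u = -log 2` the complementary sum has
exponent at most `-9/2 a m + 3 a m log 2`, and `log 2 < 7/10`. -/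
theorem one_sub_le_binomialTail (m : ℕ) {a q : ℝ} (ha : 0 ≤ a) (h1 : q ≤ 1) (hqa : 9 * a ≤ q) :
    1 - Real.exp (-(a * m)) ≤ binomialTail m (3 * a * m) q := by
  have hlog : Real.log 2 < 7 / 10 := by linarith [Real.log_two_lt_d9]
  have h := sum_filter_binomial_le m (fun k : ℕ => ¬ 3 * a * m ≤ (k : ℝ)) (u := -Real.log 2)
    (t := 3 * a * m) (by linarith) h1 fun k hk => by
      push Not at hk
      have : 0 < Real.log 2 := Real.log_pos one_lt_two
      nlinarith
  rw [Real.exp_neg, Real.exp_log two_pos] at h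
  have h2 : Real.exp (m * (q * ((2 : ℝ)⁻¹ - 1)) - -Real.log 2 * (3 * a * m))
      ≤ Real.exp (-(a * m)) := by
    apply Real.exp_le_exp.2
    have hm : (0 : ℝ) ≤ m := by positivity
    have h2 : m * (9 * a) ≤ m * q := by gcongr
    have h3 : 0 ≤ a * m := mul_nonneg ha hm
    nlinarith
  have := binomialTail_add m (3 * a * m) q
  linarith

/-- An even polynomial `x ↦ ρ (x²)` that is close to `1` on `[-δ, δ]` and close to `0` on
`√3 δ ≤ |x| ≤ 1`. -/
theorem exists_bump {δ ε : ℝ} (hδ : 0 < δ) (hδ1 : δ ≤ 1) (hε : 0 < ε) (hε1 : ε ≤ 1) :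
    ∃ ρ : ℝ[X], (ρ.natDegree : ℝ) ≤ 4 / δ * (Real.exp 10 * Real.log (1 / ε) + 1) ∧
      (∀ y, 0 ≤ y → y ≤ 1 → 0 ≤ ρ.eval y ∧ ρ.eval y ≤ 1) ∧
      (∀ y, 0 ≤ y → y ≤ δ ^ 2 → 1 - ε ≤ ρ.eval y) ∧
      (∀ y, 3 * δ ^ 2 ≤ y → y ≤ 1 → ρ.eval y ≤ ε) := by
  set M : ℕ := ⌈1 / δ⌉₊
  have hM1 : 1 ≤ M * δ := by
    rw [← div_le_iff₀ hδ]; exact Nat.le_ceil _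
  have hM2 : M * δ ≤ 2 := by
    have := (Nat.ceil_lt_add_one (show 0 ≤ 1 / δ by positivity)).le
    calc M * δ ≤ (1 / δ + 1) * δ := by gcongr
      _ = 1 + δ := by field_simp
      _ ≤ 2 := by linarith
  set Z : ℝ := (T ℝ M).eval (1 + 3 * δ ^ 2)
  have hy1 : (1 : ℝ) ≤ 1 + 3 * δ ^ 2 := by nlinarith
  have hZ1 : 1 ≤ Z := one_le_eval_T_real M hy1
  have hZe : Z ≤ Real.exp 5 := eval_T_le_exp_five M hδ hM2
  have hZ0 : 0 < Z := by linarith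
  -- Dividing the squared Chebyshev polynomial by `Z²` makes it a probability. Then `a` bounds it
  -- where the Chebyshev argument is in `[-1, 1]`, while `T ≥ 3` near the centre gives at least `9
  -- a`.
  set a : ℝ := 1 / Z ^ 2
  have ha0 : 0 < a := by positivity
  have hea : 1 ≤ Real.exp 10 * a := by
    rw [mul_one_div, le_div_iff₀ (by positivity), one_mul]
    calc Z ^ 2 ≤ Real.exp 5 ^ 2 := by gcongr
      _ = Real.exp 10 := by rw [← Real.exp_nat_mul]; norm_num
  have hL : 0 ≤ Real.log (1 / ε) := Real.log_nonneg (by rw [le_div_iff₀ hε]; linarith)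
  -- Since `a ≥ exp (-10)`, this many trials bring the Chernoff error `exp (-(a m))` down to `ε`.
  set m : ℕ := ⌈Real.exp 10 * Real.log (1 / ε)⌉₊
  have hm1 : Real.exp 10 * Real.log (1 / ε) ≤ m := Nat.le_ceil _
  have hm2 : (m : ℝ) ≤ Real.exp 10 * Real.log (1 / ε) + 1 :=
    (Nat.ceil_lt_add_one (by positivity)).le
  have hexp : Real.exp (-(a * m)) ≤ ε := by
    rw [Real.exp_neg, ← one_div, div_le_comm₀ (Real.exp_pos _) hε, ← Real.log_le_iff_le_exp
      (by positivity)]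
    calc Real.log (1 / ε) ≤ Real.exp 10 * a * Real.log (1 / ε) := le_mul_of_one_le_left hL hea
      _ = a * (Real.exp 10 * Real.log (1 / ε)) := by ring
      _ ≤ a * m := by gcongr
  set q : ℝ[X] := C a * ((T ℝ M).comp (C (1 + 3 * δ ^ 2) - X)) ^ 2
  have hqe : ∀ y, q.eval y = a * (T ℝ M).eval (1 + 3 * δ ^ 2 - y) ^ 2 := fun y => by
    simp [q, eval_comp]
  have hq0 : ∀ y, 0 ≤ q.eval y := fun y => by rw [hqe]; positivity
  have haZ : a * Z ^ 2 = 1 := by simp only [a]; field_simp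
  have hq1 : ∀ y, 0 ≤ y → y ≤ 1 → q.eval y ≤ 1 := fun y h0 h1 => by
    rw [hqe]
    refine le_trans ?_ haZ.le
    have := abs_eval_T_le M (x := 1 + 3 * δ ^ 2 - y) (by nlinarith) (by linarith) hy1
    gcongr a * ?_
    exact sq_le_sq' (by linarith [neg_abs_le ((T ℝ M).eval (1 + 3 * δ ^ 2 - y))])
      ((le_abs_self _).trans this)
  have hqdeg : q.natDegree ≤ 2 * M := by
    have h1 : (C (1 + 3 * δ ^ 2) - X : ℝ[X]).natDegree ≤ 1 := by compute_degree
    have h2 : (T ℝ M).natDegree ≤ M := by simp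
    calc q.natDegree ≤ (((T ℝ M).comp (C (1 + 3 * δ ^ 2) - X)) ^ 2).natDegree := natDegree_C_mul_le _ _
      _ ≤ 2 * ((T ℝ M).comp (C (1 + 3 * δ ^ 2) - X)).natDegree := natDegree_pow_le
      _ ≤ 2 * (M * 1) := by
        gcongr
        exact natDegree_comp_le.trans (by gcongr)
      _ = 2 * M := by ring
  set ρ : ℝ[X] := ∑ k ∈ Finset.range (m + 1) with 3 * a * m ≤ ((k : ℕ) : ℝ),
    q ^ k * (1 - q) ^ (m - k) * C (m.choose k : ℝ)
  have hρe : ∀ y, ρ.eval y = binomialTail m (3 * a * m) (q.eval y) := fun y => by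
    simp [ρ, binomialTail, eval_finsetSum]
  have hρdeg : ρ.natDegree ≤ 2 * M * m := by
    refine natDegree_sum_le_of_forall_le _ _ fun k hk => ?_
    have hk' : k ≤ m := by
      simp only [Finset.mem_filter, Finset.mem_range] at hk; omega
    have h1q : (1 - q).natDegree ≤ 2 * M := (natDegree_sub_le _ _).trans (by simp [hqdeg])
    calc _ ≤ (q ^ k * (1 - q) ^ (m - k)).natDegree := natDegree_mul_C_le _ _
      _ ≤ k * (2 * M) + (m - k) * (2 * M) :=
        natDegree_mul_le_of_le (natDegree_pow_le_of_le k hqdeg) (natDegree_pow_le_of_le _ h1q)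
      _ = 2 * M * m := by rw [← add_mul, Nat.add_sub_cancel' hk']; ring
  refine ⟨ρ, ?_, ?_, ?_, ?_⟩
  · have hMδ : (M : ℝ) ≤ 2 / δ := by rwa [le_div_iff₀ hδ]
    calc (ρ.natDegree : ℝ) ≤ ((2 * M * m : ℕ) : ℝ) := by exact_mod_cast hρdeg
      _ = 2 * M * m := by push_cast; ring
      _ ≤ 2 * (2 / δ) * (Real.exp 10 * Real.log (1 / ε) + 1) := by gcongr
      _ = _ := by ring
  · intro y h0 h1
    rw [hρe]
    exact ⟨binomialTail_nonneg _ _ (hq0 y) (hq1 y h0 h1),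
      binomialTail_le_one _ _ (hq0 y) (hq1 y h0 h1)⟩
  · intro y h0 h1
    rw [hρe]
    have h9 : 9 * a ≤ q.eval y := by
      rw [hqe]
      have h3 : 3 ≤ (T ℝ M).eval (1 + 3 * δ ^ 2 - y) := by
        refine le_trans ?_ (one_add_sq_mul_le_eval_T M (by nlinarith))
        have : 1 ≤ (M * δ) ^ 2 := one_le_pow₀ hM1
        nlinarith [mul_nonneg (sq_nonneg (M : ℝ)) (sub_nonneg.2 h1)]
      have : 9 ≤ (T ℝ M).eval (1 + 3 * δ ^ 2 - y) ^ 2 := by nlinarith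
      nlinarith
    have := one_sub_le_binomialTail m ha0.le (hq1 y h0 (by nlinarith)) h9
    linarith
  · intro y h0 h1
    have hy0 : 0 ≤ y := by nlinarith
    rw [hρe]
    have : q.eval y ≤ a := by
      rw [hqe]
      have := abs_eval_T_real_le_one M (x := 1 + 3 * δ ^ 2 - y)
        (abs_le.2 ⟨by nlinarith, by linarith⟩)
      have h2 : (T ℝ M).eval (1 + 3 * δ ^ 2 - y) ^ 2 ≤ 1 := (sq_le_one_iff_abs_le_one _).2 this
      nlinarith
    exact (binomialTail_le_exp m (hq0 y) (hq1 y hy0 h1) this).trans hexp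

/-- An odd polynomial `x ↦ x / (2δ) · ρ (x²)` that approximates `x / (2δ)` on `[-δ, δ]` and is
bounded by `1` on `[-1, 1]`. -/
theorem exists_amplifier {δ ε : ℝ} (hδ : 0 < δ) (hδ1 : δ ≤ 1) (hε : 0 < ε) (hε1 : ε ≤ δ / 4) :
    ∃ ρ : ℝ[X], (ρ.natDegree : ℝ) ≤ 4 / δ * (Real.exp 10 * Real.log (1 / ε) + 1) ∧
      (∀ x, |x| ≤ 1 → |x / (2 * δ) * ρ.eval (x ^ 2)| < 1) ∧
      (∀ x, |x| ≤ δ → |x / (2 * δ) * ρ.eval (x ^ 2) - x / (2 * δ)| ≤ ε) := by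
  obtain ⟨ρ, hd, h01, hin, hout⟩ := exists_bump hδ hδ1 hε (by linarith)
  refine ⟨ρ, hd, fun x hx => ?_, fun x hx => ?_⟩
  · have hx2 : x ^ 2 ≤ 1 := (sq_le_one_iff_abs_le_one x).2 hx
    obtain ⟨h0, h1⟩ := h01 (x ^ 2) (sq_nonneg x) hx2
    rw [abs_mul, abs_div, abs_of_pos (show 0 < 2 * δ by positivity), abs_of_nonneg h0, div_mul_eq_mul_div,
      div_lt_one (by positivity)]
    -- In the outer zone `ρ ≤ ε ≤ δ/4` beats the factor `1 / (2δ)`; elsewhere `|x| ≤ √3 δ < 2δ` and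
    -- `ρ ≤ 1`. The inequality is strict, as the positivity hypothesis of `fejer_riesz` requires.
    rcases le_total (3 * δ ^ 2) (x ^ 2) with h | h
    · have := hout _ h hx2
      nlinarith [abs_nonneg x]
    · have : |x| < 2 * δ := abs_lt_of_sq_lt_sq (by nlinarith) (by positivity)
      nlinarith [abs_nonneg x]
  · have hx2 : x ^ 2 ≤ δ ^ 2 := sq_le_sq' (neg_le_of_abs_le hx) (le_of_abs_le hx)
    have h1 := (h01 (x ^ 2) (sq_nonneg x) (by nlinarith)).2
    have h2 := hin _ (sq_nonneg x) hx2
    have : x / (2 * δ) * ρ.eval (x ^ 2) - x / (2 * δ) = x / (2 * δ) * (ρ.eval (x ^ 2) - 1) := by ring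
    rw [this, abs_mul, abs_div, abs_of_pos (show 0 < 2 * δ by positivity)]
    have h3 : |x| / (2 * δ) ≤ 1 := by rw [div_le_one (by positivity)]; linarith
    have h4 : |ρ.eval (x ^ 2) - 1| ≤ ε := abs_le.2 ⟨by linarith, by linarith⟩
    calc _ ≤ 1 * ε := by gcongr
      _ = ε := one_mul ε

end Approximation

/-! ### Fejér–Riesz factorization and complementary polynomials. -/

section FejerRiesz
open Polynomial ComplexConjugate

theorem infinite_unit_circle : {z : ℂ | ‖z‖ = 1}.Infinite := by
  have h : IsPreconnected (Metric.sphere (0 : ℂ) 1) :=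
    isPreconnected_sphere (by rw [Complex.rank_real_complex]; norm_num) 0 1
  have h2 : (Metric.sphere (0 : ℂ) 1).Nontrivial :=
    ⟨1, by simp, -1, by simp, by norm_num⟩
  convert h.infinite_of_nontrivial h2 using 1
  ext z
  simp

theorem eq_of_eval_eq_on_circle {p q : ℂ[X]} (h : ∀ z : ℂ, ‖z‖ = 1 → p.eval z = q.eval z) :
    p = q :=
  eq_of_infinite_eval_eq p q (infinite_unit_circle.mono h)

/-- The polynomial `z ^ N * conj (p (1 / conj z))`. -/
noncomputable def conjReflect (N : ℕ) (p : ℂ[X]) : ℂ[X] := (p.map (starRingEnd ℂ)).reflect N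

theorem eval_conjReflect {N : ℕ} {p : ℂ[X]} (hp : p.natDegree ≤ N) {z : ℂ} (hz : z ≠ 0) :
    (conjReflect N p).eval z = z ^ N * conj (p.eval (conj z)⁻¹) := by
  let u : Invertible z⁻¹ := invertibleOfNonzero (inv_ne_zero hz)
  have h := eval₂_reflect_mul_pow (RingHom.id ℂ) z⁻¹ N (p.map (starRingEnd ℂ))
    ((natDegree_map_le).trans hp)
  rw [invOf_eq_inv, inv_inv, ← eval, ← eval] at h
  have h2 : (p.map (starRingEnd ℂ)).eval z⁻¹ = conj (p.eval (conj z)⁻¹) := by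
    have := Polynomial.eval_map_apply (starRingEnd ℂ) (p := p) (conj z)⁻¹
    rw [← this]; simp
  rw [← h2, ← h, conjReflect, mul_comm, mul_assoc, ← mul_pow, inv_mul_cancel₀ hz, one_pow, mul_one]

theorem inv_conj_of_norm_eq_one {z : ℂ} (hz : ‖z‖ = 1) : (conj z)⁻¹ = z := by
  rw [← Complex.inv_eq_conj hz, inv_inv]

theorem ne_zero_of_norm_eq_one {z : ℂ} (hz : ‖z‖ = 1) : z ≠ 0 := by
  rintro rfl; simp at hz

theorem eval_conjReflect_of_norm_eq_one {N : ℕ} {p : ℂ[X]} (hp : p.natDegree ≤ N) {z : ℂ}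
    (hz : ‖z‖ = 1) : (conjReflect N p).eval z = z ^ N * conj (p.eval z) := by
  rw [eval_conjReflect hp (ne_zero_of_norm_eq_one hz), inv_conj_of_norm_eq_one hz]

theorem coeff_conjReflect_zero (N : ℕ) (p : ℂ[X]) :
    (conjReflect N p).coeff 0 = conj (p.coeff N) := by
  simp [conjReflect, coeff_reflect, revAt_le]

/-- Reality of `z ^ (-N) * R z` on the circle is a symmetry of the coefficients; it pairs each root
`a` with `1 / conj a`. -/
theorem conjReflect_eq_self {N : ℕ} {R : ℂ[X]} (hd : R.natDegree ≤ 2 * N)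
    (hR : ∀ z : ℂ, ‖z‖ = 1 → ∃ r : ℝ, R.eval z = z ^ N * r) : conjReflect (2 * N) R = R := by
  refine eq_of_eval_eq_on_circle fun z hz => ?_
  obtain ⟨r, hr⟩ := hR z hz
  have h1 : z * conj z = 1 := by rw [Complex.mul_conj, Complex.normSq_eq_norm_sq, hz]; simp
  rw [eval_conjReflect_of_norm_eq_one hd hz, hr, map_mul, map_pow, Complex.conj_ofReal, two_mul,
    pow_add, mul_assoc, ← mul_assoc (z ^ N) (conj z ^ N), ← mul_pow, h1, one_pow, one_mul]

theorem eval_linear_mul_conj {z : ℂ} (hz : ‖z‖ = 1) (a : ℂ) :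
    (z - a) * (1 - conj a * z) = z * (‖z - a‖ ^ 2 : ℝ) := by
  have h1 : z * conj z = 1 := by rw [Complex.mul_conj, Complex.normSq_eq_norm_sq, hz]; simp
  rw [← Complex.normSq_eq_norm_sq, Complex.normSq_eq_conj_mul_self, map_sub]
  linear_combination (a - z) * h1

/-- The roots `a` and `1 / conj a` are distinct because positivity excludes roots on the circle, so
both can be divided out together. The extracted product equals `z |z - a|²` there, which keeps the
quotient positive. -/
theorem exists_linear_factor {N : ℕ} {R : ℂ[X]} (hd : R.natDegree ≤ 2 * (N + 1))
    (hR : ∀ z : ℂ, ‖z‖ = 1 → ∃ r : ℝ, 0 < r ∧ R.eval z = z ^ (N + 1) * r) :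
    ∃ (a : ℂ) (S : ℂ[X]), ‖a‖ ≠ 1 ∧ S.natDegree ≤ 2 * N ∧
      R = (X - C a) * (1 - C (conj a) * X) * S := by
  have hself := conjReflect_eq_self hd fun z hz => (hR z hz).imp fun r h => h.2
  have hR0 : R ≠ 0 := by
    rintro rfl
    obtain ⟨r, hr, h⟩ := hR 1 (by simp)
    simp at h
    exact hr.ne (by exact_mod_cast h)
  have hcoeff : R.coeff 0 = conj (R.coeff (2 * (N + 1))) := by
    rw [← coeff_conjReflect_zero, hself]
  have hroot : ∀ a, R.IsRoot a → ‖a‖ ≠ 1 := fun a ha h1 => by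
    obtain ⟨r, hr, h⟩ := hR a h1
    rw [ha.eq_zero] at h
    have := ne_zero_of_norm_eq_one h1
    have : (r : ℂ) ≠ 0 := by exact_mod_cast hr.ne'
    simp_all
  -- If `0` is a root, its partner is at infinity: by symmetry the top coefficient vanishes too, so
  -- removing one factor `X` lowers the degree bound by two.
  by_cases h0 : R.coeff 0 = 0
  · refine ⟨0, R.divX, by simp, ?_, ?_⟩
    · have : R.natDegree ≠ 2 * (N + 1) := fun h => by
        rw [h0, ← h, coeff_natDegree, eq_comm, map_eq_zero, leadingCoeff_eq_zero] at hcoeff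
        exact hR0 hcoeff
      rw [natDegree_divX_eq_natDegree_tsub_one]
      omega
    · conv_lhs => rw [← R.divX_mul_X_add, h0]
      simp [mul_comm]
  · have hdeg : R.degree ≠ 0 := fun h => by
      have h1 : R.natDegree = 0 := natDegree_eq_of_degree_eq_some h
      have h2 : R.coeff (2 * (N + 1)) = 0 := coeff_eq_zero_of_natDegree_lt (by omega)
      rw [h2, map_zero] at hcoeff
      exact h0 hcoeff
    obtain ⟨a, ha⟩ := Complex.exists_root (f := R) (by
      rcases lt_or_gt_of_ne hdeg with h | h
      · exact absurd (by simpa using h : R = 0) hR0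
      · exact h)
    have ha0 : a ≠ 0 := by
      rintro rfl
      exact h0 (by rw [coeff_zero_eq_eval_zero]; exact ha)
    have hca : conj a ≠ 0 := (_root_.map_ne_zero _).2 ha0
    have ha1 := hroot a ha
    have hb : R.IsRoot (conj a)⁻¹ := by
      have h := eval_conjReflect hd (inv_ne_zero hca)
      rw [hself] at h
      rw [IsRoot, h]
      simp [ha.eq_zero]
    have hab : (conj a)⁻¹ ≠ a := fun h => ha1 (by
      have h2 : a * conj a = 1 := by
        nth_rewrite 1 [← h]; exact inv_mul_cancel₀ hca
      rw [Complex.mul_conj, Complex.normSq_eq_norm_sq] at h2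
      have h3 : ‖a‖ ^ 2 = 1 := by exact_mod_cast h2
      rwa [pow_eq_one_iff_of_nonneg (norm_nonneg a) two_ne_zero] at h3)
    obtain ⟨Q, hQ⟩ := dvd_iff_isRoot.2 ha
    have hQb : Q.IsRoot (conj a)⁻¹ := by
      rw [hQ, IsRoot, eval_mul] at hb
      simpa [sub_eq_zero, hab] using hb
    obtain ⟨S, hS⟩ := dvd_iff_isRoot.2 hQb
    have hlin : (1 - C (conj a) * X : ℂ[X]) = -C (conj a) * (X - C (conj a)⁻¹) := by
      have : (C (conj a) * C (conj a)⁻¹ : ℂ[X]) = 1 := by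
        rw [← C_mul, mul_inv_cancel₀ hca, C_1]
      linear_combination -this
    have hcc : (C (conj a)⁻¹ * C (conj a) : ℂ[X]) = 1 := by
        rw [← C_mul, inv_mul_cancel₀ hca, C_1]
    refine ⟨a, -C (conj a)⁻¹ * S, ha1, ?_, ?_⟩
    · have hS0 : S ≠ 0 := by rintro rfl; simp_all
      have h1 : R.natDegree = 1 + (1 + S.natDegree) := by
        rw [hQ, hS, natDegree_mul (X_sub_C_ne_zero _) (mul_ne_zero (X_sub_C_ne_zero _) hS0),
          natDegree_mul (X_sub_C_ne_zero _) hS0, natDegree_X_sub_C, natDegree_X_sub_C]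
      have h2 : (-C (conj a)⁻¹ * S).natDegree ≤ S.natDegree := by
        rw [← C_neg]; exact natDegree_C_mul_le _ _
      omega
    · rw [hlin, hQ, hS]
      linear_combination -(X - C a) * (X - C (conj a)⁻¹) * S * hcc

/-- The Fejér–Riesz theorem for a trigonometric polynomial `z ^ (-N) * R z` that is positive on the
unit circle. -/
theorem fejer_riesz (N : ℕ) : ∀ R : ℂ[X], R.natDegree ≤ 2 * N →
    (∀ z : ℂ, ‖z‖ = 1 → ∃ r : ℝ, 0 < r ∧ R.eval z = z ^ N * r) →
    ∃ G : ℂ[X], G.natDegree ≤ N ∧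
      ∀ z : ℂ, ‖z‖ = 1 → R.eval z = z ^ N * (‖G.eval z‖ ^ 2 : ℝ) := by
  induction N with
  | zero =>
    intro R hd hR
    obtain ⟨r, hr, h⟩ := hR 1 (by simp)
    rw [eq_C_of_natDegree_le_zero (p := R) (by omega)] at h ⊢
    simp only [eval_C, pow_zero, one_mul] at h
    refine ⟨C (Real.sqrt r : ℂ), by simp, fun z _ => ?_⟩
    simp only [eval_C, h, Complex.norm_real, Real.norm_eq_abs, sq_abs, Real.sq_sqrt hr.le, pow_zero,
      one_mul]
  | succ N ih =>
    intro R hd hR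
    obtain ⟨a, S, ha, hS, hRS⟩ := exists_linear_factor hd hR
    have hev : ∀ z : ℂ, ‖z‖ = 1 → R.eval z = z * (‖z - a‖ ^ 2 : ℝ) * S.eval z := fun z hz => by
      rw [hRS, ← eval_linear_mul_conj hz]; simp
    have hne : ∀ z : ℂ, ‖z‖ = 1 → 0 < ‖z - a‖ := fun z hz => by
      rw [norm_pos_iff, sub_ne_zero]; rintro rfl; exact ha hz
    obtain ⟨G, hG, hGS⟩ := ih S hS fun z hz => by
      obtain ⟨r, hr, h⟩ := hR z hz
      have h2 := hne z hz
      refine ⟨r / ‖z - a‖ ^ 2, by positivity, ?_⟩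
      have hz0 := ne_zero_of_norm_eq_one hz
      have h3 : (‖z - a‖ : ℂ) ≠ 0 := by exact_mod_cast h2.ne'
      rw [hev z hz, pow_succ] at h
      push_cast at h ⊢
      rw [← mul_div_assoc, eq_div_iff (pow_ne_zero 2 h3)]
      apply mul_left_cancel₀ hz0
      linear_combination h
    refine ⟨(X - C a) * G, ?_, fun z hz => ?_⟩
    · exact (natDegree_mul_le_of_le (natDegree_X_sub_C_le a) hG).trans (by omega)
    · rw [hev z hz, hGS z hz]
      simp only [eval_mul, eval_sub, eval_X, eval_C, norm_mul]
      push_cast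
      ring

/-- A polynomial bounded by `1` on the unit circle has a complementary polynomial. -/
theorem exists_complement {N : ℕ} {F : ℂ[X]} (hd : F.natDegree ≤ N)
    (hF : ∀ z : ℂ, ‖z‖ = 1 → ‖F.eval z‖ < 1) :
    ∃ G : ℂ[X], G.natDegree ≤ N ∧
      ∀ z : ℂ, ‖z‖ = 1 → ‖F.eval z‖ ^ 2 + ‖G.eval z‖ ^ 2 = 1 := by
  have hev : ∀ z : ℂ, ‖z‖ = 1 →
      (X ^ N - F * conjReflect N F).eval z = z ^ N * ((1 - ‖F.eval z‖ ^ 2 : ℝ) : ℂ) := fun z hz => by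
    rw [eval_sub, eval_mul, eval_conjReflect_of_norm_eq_one hd hz, ← Complex.normSq_eq_norm_sq]
    push_cast
    rw [← Complex.mul_conj]
    simp only [eval_pow, eval_X]
    ring
  obtain ⟨G, hG, h⟩ := fejer_riesz N (X ^ N - F * conjReflect N F) (by
    have h1 : (conjReflect N F).natDegree ≤ N := by
      refine natDegree_le_iff_coeff_eq_zero.2 fun k hk => ?_
      rw [conjReflect, coeff_reflect, revAt_eq_self_of_lt hk]
      exact coeff_eq_zero_of_natDegree_lt (natDegree_map_le.trans_lt (hd.trans_lt hk))
    refine (natDegree_sub_le _ _).trans (max_le ((natDegree_X_pow_le N).trans (by omega)) ?_)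
    exact (natDegree_mul_le_of_le hd h1).trans (by omega)) fun z hz =>
      ⟨_, by nlinarith [hF z hz, norm_nonneg (F.eval z)], hev z hz⟩
  refine ⟨G, hG, fun z hz => ?_⟩
  have h2 := mul_left_cancel₀ (pow_ne_zero N (ne_zero_of_norm_eq_one hz))
    ((hev z hz).symm.trans (h z hz))
  have h3 : 1 - ‖F.eval z‖ ^ 2 = ‖G.eval z‖ ^ 2 := by exact_mod_cast h2
  linarith

end FejerRiesz

/-! ### Quantum signal processing: factoring a complementary pair into rotations. -/

section SignalProcessing
open Polynomial ComplexConjugate Matrix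

/-- The matrix in `SU(2)` with first column `(f, g)`. -/
def su2 (f g : ℂ) : Matrix (Fin 2) (Fin 2) ℂ := !![f, -conj g; g, conj f]

theorem su2_mem {f g : ℂ} (h : ‖f‖ ^ 2 + ‖g‖ ^ 2 = 1) : su2 f g ∈ unitaryGroup (Fin 2) ℂ := by
  have h' : f * conj f + g * conj g = 1 := by
    rw [Complex.mul_conj, Complex.mul_conj, Complex.normSq_eq_norm_sq, Complex.normSq_eq_norm_sq]
    exact_mod_cast h
  rw [mem_unitaryGroup_iff, star_eq_conjTranspose]
  ext i j
  fin_cases i <;> fin_cases j <;> simp [su2, mul_apply, Fin.sum_univ_two]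
  · linear_combination h'
  · ring
  · ring
  · linear_combination h'

theorem norm_sq_div_sqrt (u v : ℂ) (h : ‖u‖ ^ 2 + ‖v‖ ^ 2 ≠ 0) :
    ‖u / (√(‖u‖ ^ 2 + ‖v‖ ^ 2) : ℝ)‖ ^ 2 + ‖v / (√(‖u‖ ^ 2 + ‖v‖ ^ 2) : ℝ)‖ ^ 2 = 1 := by
  have h0 : 0 ≤ ‖u‖ ^ 2 + ‖v‖ ^ 2 := by positivity
  rw [norm_div, norm_div, Complex.norm_real, Real.norm_eq_abs, div_pow, div_pow, sq_abs,
    Real.sq_sqrt h0, ← add_div, div_self h]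

theorem norm_sq_add_eq_zero {u v : ℂ} (h : ‖u‖ ^ 2 + ‖v‖ ^ 2 = 0) : u = 0 ∧ v = 0 := by
  have h1 : ‖u‖ ^ 2 = 0 := by nlinarith [sq_nonneg ‖u‖, sq_nonneg ‖v‖]
  have h2 : ‖v‖ ^ 2 = 0 := by nlinarith [sq_nonneg ‖u‖, sq_nonneg ‖v‖]
  exact ⟨by simpa using h1, by simpa using h2⟩

/-- The unit vector `(f, g)` must be parallel to `v` and orthogonal to `u`: normalize `v`, or a
vector orthogonal to `u` if `v = 0`. -/
theorem exists_rotation {u₀ u₁ v₀ v₁ : ℂ} (h : u₀ * conj v₀ + u₁ * conj v₁ = 0) :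
    ∃ f g : ℂ, ‖f‖ ^ 2 + ‖g‖ ^ 2 = 1 ∧ conj f * u₀ + conj g * u₁ = 0 ∧ f * v₁ - g * v₀ = 0 := by
  by_cases hv : ‖v₀‖ ^ 2 + ‖v₁‖ ^ 2 = 0
  · obtain ⟨rfl, rfl⟩ := norm_sq_add_eq_zero hv
    by_cases hu : ‖-conj u₁‖ ^ 2 + ‖conj u₀‖ ^ 2 = 0
    · obtain ⟨h1, h2⟩ := norm_sq_add_eq_zero hu
      have h1' : u₁ = 0 := by simpa using h1
      have h2' : u₀ = 0 := by simpa using h2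
      exact ⟨1, 0, by simp, by simp [h2'], by simp⟩
    · refine ⟨_, _, norm_sq_div_sqrt _ _ hu, ?_, by ring⟩
      simp only [map_div₀, map_neg, Complex.conj_conj, Complex.conj_ofReal]
      ring
  · refine ⟨_, _, norm_sq_div_sqrt _ _ hv, ?_, by ring⟩
    simp only [map_div₀, Complex.conj_ofReal]
    rw [div_mul_eq_mul_div, div_mul_eq_mul_div, ← add_div]
    rw [mul_comm (conj v₀), mul_comm (conj v₁), h, zero_div]

/-- The signal operator `diag (w, w⁻¹)`. -/
noncomputable def signal (w : ℂ) : Matrix (Fin 2) (Fin 2) ℂ := diagonal ![w, w⁻¹]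

/-- Alternate the signal operator with the rotations of the list `l`. -/
noncomputable def process (w : ℂ) (l : List (unitaryGroup (Fin 2) ℂ)) (A : Fin 2 → ℂ) : Fin 2 → ℂ :=
  l.foldl (fun A V => V.1 *ᵥ (signal w *ᵥ A)) A

theorem process_concat (w : ℂ) (l : List (unitaryGroup (Fin 2) ℂ)) (V : unitaryGroup (Fin 2) ℂ)
    (A : Fin 2 → ℂ) : process w (l ++ [V]) A =
      (V : Matrix (Fin 2) (Fin 2) ℂ) *ᵥ (signal w *ᵥ process w l A) := by
  simp only [process, List.foldl_append, List.foldl_cons, List.foldl_nil]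

/-- On the circle `|F|² + |G|² = 1` becomes a polynomial identity with right side `X ^ (N + 1)`; its
constant coefficient is the claim. -/
theorem orthogonal_coeff {N : ℕ} {F G : ℂ[X]} (hF : F.natDegree ≤ N + 1)
    (hG : G.natDegree ≤ N + 1)
    (h : ∀ z : ℂ, ‖z‖ = 1 → ‖F.eval z‖ ^ 2 + ‖G.eval z‖ ^ 2 = 1) :
    F.coeff 0 * conj (F.coeff (N + 1)) + G.coeff 0 * conj (G.coeff (N + 1)) = 0 := by
  have key : F * conjReflect (N + 1) F + G * conjReflect (N + 1) G = X ^ (N + 1) := by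
    refine eq_of_eval_eq_on_circle fun z hz => ?_
    rw [eval_add, eval_mul, eval_mul, eval_conjReflect_of_norm_eq_one hF hz,
      eval_conjReflect_of_norm_eq_one hG hz]
    have h1 : F.eval z * conj (F.eval z) + G.eval z * conj (G.eval z) = 1 := by
      rw [Complex.mul_conj, Complex.mul_conj, Complex.normSq_eq_norm_sq, Complex.normSq_eq_norm_sq]
      exact_mod_cast h z hz
    simp only [eval_pow, eval_X]
    linear_combination z ^ (N + 1) * h1
  have h0 := congrArg (fun p => coeff p 0) key
  simpa [mul_coeff_zero, coeff_conjReflect_zero] using h0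

theorem norm_sq_rotate {f g : ℂ} (h : ‖f‖ ^ 2 + ‖g‖ ^ 2 = 1) (a b : ℂ) :
    ‖conj f * a + conj g * b‖ ^ 2 + ‖f * b - g * a‖ ^ 2 = ‖a‖ ^ 2 + ‖b‖ ^ 2 := by
  have h' : f * conj f + g * conj g = 1 := by
    rw [Complex.mul_conj, Complex.mul_conj, Complex.normSq_eq_norm_sq, Complex.normSq_eq_norm_sq]
    exact_mod_cast h
  apply Complex.ofReal_injective
  simp only [← Complex.normSq_eq_norm_sq, Complex.ofReal_add, Complex.normSq_eq_conj_mul_self,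
    map_add, map_sub, map_mul, Complex.conj_conj]
  linear_combination (a * conj a + b * conj b) * h'

/-- Every complementary pair of polynomials is generated by alternating the signal operator with
unitary rotations. -/
theorem exists_process (N : ℕ) : ∀ F G : ℂ[X], F.natDegree ≤ N → G.natDegree ≤ N →
    (∀ z : ℂ, ‖z‖ = 1 → ‖F.eval z‖ ^ 2 + ‖G.eval z‖ ^ 2 = 1) →
    ∃ (V₀ : unitaryGroup (Fin 2) ℂ) (l : List (unitaryGroup (Fin 2) ℂ)), l.length = N ∧
      ∀ w : ℂ, ‖w‖ = 1 → w ^ N • process w l ((V₀ : Matrix (Fin 2) (Fin 2) ℂ) *ᵥ ![1, 0])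
        = ![F.eval (w ^ 2), G.eval (w ^ 2)] := by
  induction N with
  | zero =>
    intro F G hF hG h
    rw [eq_C_of_natDegree_le_zero hF, eq_C_of_natDegree_le_zero hG] at h ⊢
    simp only [eval_C] at h ⊢
    refine ⟨⟨su2 _ _, su2_mem (h 1 (by simp))⟩, [], rfl, fun w _ => ?_⟩
    ext i
    fin_cases i <;> simp [process, su2]
  | succ N ih =>
    intro F G hF hG h
    -- Undoing this rotation kills the constant term of the first component and the top coefficient
    -- of the second. Undoing the signal operator then divides the first by `X`, and both have
    -- degree at most `N`.
    obtain ⟨f, g, hfg, h0, h1⟩ := exists_rotation (orthogonal_coeff hF hG h)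
    have hc : f * conj f + g * conj g = 1 := by
      rw [Complex.mul_conj, Complex.mul_conj, Complex.normSq_eq_norm_sq,
        Complex.normSq_eq_norm_sq]
      exact_mod_cast hfg
    set F₁ : ℂ[X] := C (conj f) * F + C (conj g) * G
    set G₁ : ℂ[X] := C f * G - C g * F
    have hF₁ : F₁.divX * X = F₁ := by
      conv_rhs => rw [← F₁.divX_mul_X_add]
      have : F₁.coeff 0 = 0 := by simpa [F₁] using h0
      rw [this, C_0, add_zero]
    have hF₁d : F₁.natDegree ≤ N + 1 :=
      (natDegree_add_le _ _).trans (max_le ((natDegree_C_mul_le _ _).trans hF)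
        ((natDegree_C_mul_le _ _).trans hG))
    have hG₁d : G₁.natDegree ≤ N + 1 :=
      (natDegree_sub_le _ _).trans (max_le ((natDegree_C_mul_le _ _).trans hG)
        ((natDegree_C_mul_le _ _).trans hF))
    have hG₁d' : G₁.natDegree ≤ N := by
      refine natDegree_le_iff_coeff_eq_zero.2 fun k hk => ?_
      rcases (Nat.succ_le_of_lt hk).eq_or_lt with rfl | hk'
      · simpa [G₁] using h1
      · exact coeff_eq_zero_of_natDegree_lt (by omega)
    obtain ⟨V₀, l, hl, hw⟩ := ih F₁.divX G₁
      (by rw [natDegree_divX_eq_natDegree_tsub_one]; omega) hG₁d' fun z hz => by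
        have h2 : ‖F₁.divX.eval z‖ = ‖F₁.eval z‖ := by
          conv_rhs => rw [← hF₁]
          simp [hz]
        rw [h2, ← h z hz]
        simp only [F₁, G₁, eval_add, eval_sub, eval_mul, eval_C]
        exact norm_sq_rotate hfg _ _
    refine ⟨V₀, l ++ [⟨su2 f g, su2_mem hfg⟩], by simp [hl], fun w hwn => ?_⟩
    have hw0 := ne_zero_of_norm_eq_one hwn
    have h3 : F₁.eval (w ^ 2) = F₁.divX.eval (w ^ 2) * w ^ 2 := by
      conv_lhs => rw [← hF₁]
      simp
    have h4 := hw w hwn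
    have e0 := congrFun h4 0
    have e1 := congrFun h4 1
    rw [process_concat]
    generalize process w l ((V₀ : Matrix (Fin 2) (Fin 2) ℂ) *ᵥ ![1, 0]) = A at e0 e1 ⊢
    simp only [Pi.smul_apply, smul_eq_mul, cons_val_zero, cons_val_one] at e0 e1
    have e0' : F₁.eval (w ^ 2) = w ^ (N + 1) * (w * A 0) := by rw [h3, ← e0]; ring
    have e1' : G₁.eval (w ^ 2) = w ^ (N + 1) * (w⁻¹ * A 1) := by
      rw [← e1, pow_succ]; field_simp
    simp only [F₁, G₁, eval_add, eval_sub, eval_mul, eval_C] at e0' e1'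
    ext i
    fin_cases i
    · simp [su2, signal]
      linear_combination -f * e0' + conj g * e1' + F.eval (w ^ 2) * hc
    · simp [su2, signal]
      linear_combination -g * e0' - conj f * e1' + G.eval (w ^ 2) * hc

/-- On the circle `w² + 1 = 2 w Re w`, so an odd polynomial in `Re w` times the right odd power of
`w` is a polynomial in `w²`. -/
theorem exists_polynomial_sq (ρ : ℝ[X]) (κ : ℝ) :
    ∃ F : ℂ[X], F.natDegree ≤ 2 * ρ.natDegree + 1 ∧ ∀ w : ℂ, ‖w‖ = 1 →
      F.eval (w ^ 2) = w ^ (2 * ρ.natDegree + 1) * ((w.re * κ * ρ.eval (w.re ^ 2) : ℝ) : ℂ) := by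
  refine ⟨C (κ / 2 : ℂ) * ((X + 1) * ∑ k ∈ Finset.range (ρ.natDegree + 1),
    C (ρ.coeff k / 4 ^ k : ℂ) * ((X + 1) ^ (2 * k) * X ^ (ρ.natDegree - k))), ?_, fun w hw => ?_⟩
  · have h1 : (X + 1 : ℂ[X]).natDegree ≤ 1 := by compute_degree
    refine (natDegree_C_mul_le _ _).trans ((natDegree_mul_le_of_le h1
      (natDegree_sum_le_of_forall_le _ _ fun k hk => ?_)).trans (add_comm _ _).le)
    refine (natDegree_C_mul_le _ _).trans ((natDegree_mul_le_of_le
      (natDegree_pow_le_of_le (2 * k) h1) (natDegree_X_pow_le _)).trans ?_)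
    have := Finset.mem_range.1 hk
    omega
  · have hre : w ^ 2 + 1 = 2 * w * w.re := by
      have h1 : w * conj w = 1 := by rw [Complex.mul_conj, Complex.normSq_eq_norm_sq, hw]; simp
      have h2 := Complex.add_conj w
      push_cast at h2
      linear_combination w * h2 - h1
    rw [Polynomial.eval_eq_sum_range (p := ρ)]
    simp only [eval_mul, eval_C, eval_add, eval_X, eval_one, eval_finsetSum, eval_pow, hre]
    push_cast
    rw [Finset.mul_sum, Finset.mul_sum, Finset.mul_sum, Finset.mul_sum]
    refine Finset.sum_congr rfl fun k hk => ?_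
    have hk' : k ≤ ρ.natDegree := by have := Finset.mem_range.1 hk; omega
    have h4 : (2 * w * w.re) ^ (2 * k) = 4 ^ k * w ^ (2 * k) * (w.re ^ 2) ^ k := by
      rw [mul_pow, mul_pow, pow_mul 2]; norm_num [pow_mul]
    have h5 : w ^ (2 * ρ.natDegree + 1) = w * w ^ (2 * k) * (w ^ 2) ^ (ρ.natDegree - k) := by
      rw [← pow_mul, ← pow_succ', ← pow_add]; congr 1; omega
    rw [h4, h5]
    have : (4 : ℂ) ^ k ≠ 0 := pow_ne_zero k (by norm_num)
    field_simp

end SignalProcessing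

/-! ### Gates on the joint register, their action on vectors and their unitarity. -/

section Gates
open Matrix

variable {a s : Type} [Fintype a] [DecidableEq a] [Zero a] [Fintype s] [DecidableEq s]

/-- Act on the qubit `c` by `V` if the ancilla register `a` is in the state `|0⟩`, and by `W`
otherwise. -/
def ctrlGate (a s : Type) [DecidableEq a] [Zero a] [DecidableEq s]
    (V W : Matrix (Fin 2) (Fin 2) ℂ) : Matrix (Anc a × s) (Anc a × s) ℂ :=
  Matrix.of fun x y => if x.1.2 = y.1.2 ∧ x.2 = y.2 then
    (if x.1.2.2 = 0 then V else W) x.1.1 y.1.1 else 0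

theorem ctrlGate_mulVec (V W : Matrix (Fin 2) (Fin 2) ℂ) (f : Anc a × s → ℂ) (c b : Fin 2) (i : a)
    (j : s) : (ctrlGate a s V W *ᵥ f) ((c, b, i), j)
      = ((if i = 0 then V else W) *ᵥ fun c' => f ((c', b, i), j)) c := by
  simp only [mulVec, dotProduct, ctrlGate, of_apply, Fintype.sum_prod_type, ite_mul, zero_mul]
  refine Finset.sum_congr rfl fun c' _ => ?_
  simp only [Prod.mk.injEq, ite_and, Finset.sum_ite_eq, Finset.mem_univ, if_true,
    Finset.sum_ite_irrel, Finset.sum_const_zero]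

theorem ctrlGate_mul (V W V' W' : Matrix (Fin 2) (Fin 2) ℂ) :
    ctrlGate a s V W * ctrlGate a s V' W' = ctrlGate a s (V * V') (W * W') := by
  refine ext_of_mulVec_single fun k => ?_
  ext ⟨⟨c, b, i⟩, j⟩
  rw [← mulVec_mulVec, ctrlGate_mulVec, ctrlGate_mulVec]
  simp only [ctrlGate_mulVec]
  split_ifs with h <;> rw [← mulVec_mulVec]

theorem ctrlGate_one : ctrlGate a s 1 1 = 1 := by
  ext ⟨⟨c, b, i⟩, j⟩ ⟨⟨c', b', i'⟩, j'⟩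
  simp only [ctrlGate, of_apply, ite_self, one_apply, Prod.mk.injEq]
  split_ifs <;> simp_all

theorem ctrlGate_conjTranspose (V W : Matrix (Fin 2) (Fin 2) ℂ) :
    (ctrlGate a s V W)ᴴ = ctrlGate a s Vᴴ Wᴴ := by
  ext ⟨⟨c, b, i⟩, j⟩ ⟨⟨c', b', i'⟩, j'⟩
  simp only [ctrlGate, of_apply, conjTranspose_apply, Prod.mk.injEq]
  by_cases h : (b = b' ∧ i = i') ∧ j = j'
  · obtain ⟨⟨rfl, rfl⟩, rfl⟩ := h
    simp only [and_self, if_true]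
    split_ifs <;> simp [conjTranspose_apply]
  · rw [if_neg h, if_neg (by rintro ⟨⟨rfl, rfl⟩, rfl⟩; simp at h), star_zero]

theorem ctrlGate_mem {V W : Matrix (Fin 2) (Fin 2) ℂ} (hV : V ∈ unitaryGroup (Fin 2) ℂ)
    (hW : W ∈ unitaryGroup (Fin 2) ℂ) : ctrlGate a s V W ∈ unitaryGroup (Anc a × s) ℂ := by
  rw [mem_unitaryGroup_iff, star_eq_conjTranspose] at *
  rw [ctrlGate_conjTranspose, ctrlGate_mul, hV, hW, ctrlGate_one]

/-- Flip the qubit `b` of a basis state. -/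
def flipEquiv (a s : Type) : Anc a × s ≃ Anc a × s where
  toFun x := ((x.1.1, x.1.2.1 + 1, x.1.2.2), x.2)
  invFun x := ((x.1.1, x.1.2.1 + 1, x.1.2.2), x.2)
  left_inv x := by
    obtain ⟨⟨c, b, i⟩, j⟩ := x
    fin_cases b <;> rfl
  right_inv x := by
    obtain ⟨⟨c, b, i⟩, j⟩ := x
    fin_cases b <;> rfl

/-- The Pauli gate `X` on the qubit `b`. -/
def flipGate (a s : Type) [DecidableEq a] [DecidableEq s] : Matrix (Anc a × s) (Anc a × s) ℂ :=
  (1 : Matrix (Anc a × s) (Anc a × s) ℂ).submatrix (flipEquiv a s) id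

theorem flipGate_mulVec (f : Anc a × s → ℂ) (x : Anc a × s) :
    (flipGate a s *ᵥ f) x = f (flipEquiv a s x) := by
  change ((1 : Matrix (Anc a × s) (Anc a × s) ℂ) *ᵥ f) (flipEquiv a s x) = _
  rw [one_mulVec]

theorem flipGate_mem : flipGate a s ∈ unitaryGroup (Anc a × s) ℂ := by
  rw [mem_unitaryGroup_iff, star_eq_conjTranspose, flipGate, conjTranspose_submatrix,
    conjTranspose_one, ← submatrix_mul _ _ _ _ _ Function.bijective_id, one_mul]
  exact submatrix_one_equiv _

theorem controlled_mulVec (U : Matrix (a × s) (a × s) ℂ) (f : Anc a × s → ℂ) (c b : Fin 2) (i : a)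
    (j : s) : (controlled U *ᵥ f) ((c, b, i), j)
      = ((if b = 1 then U else 1) *ᵥ fun y => f ((c, b, y.1), y.2)) (i, j) := by
  simp only [mulVec, dotProduct, controlled, of_apply, Fintype.sum_prod_type, ite_mul, zero_mul]
  simp only [ite_and, Finset.sum_ite_eq, Finset.mem_univ, if_true,
    Finset.sum_ite_irrel, Finset.sum_const_zero]

theorem controlled_conjTranspose (U : Matrix (a × s) (a × s) ℂ) :
    (controlled U)ᴴ = controlled Uᴴ := by
  ext ⟨⟨c, b, i⟩, j⟩ ⟨⟨c', b', i'⟩, j'⟩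
  simp only [controlled, of_apply, conjTranspose_apply]
  by_cases h : c = c' ∧ b = b'
  · obtain ⟨rfl, rfl⟩ := h
    simp only [and_self, if_true]
    split_ifs
    · simp [conjTranspose_apply]
    · rw [← conjTranspose_apply, conjTranspose_one]
  · rw [if_neg h, if_neg (by rintro ⟨rfl, rfl⟩; simp at h), star_zero]

theorem controlled_mem {U : Matrix (a × s) (a × s) ℂ} (hU : U ∈ unitaryGroup (a × s) ℂ) :
    controlled U ∈ unitaryGroup (Anc a × s) ℂ := by
  rw [mem_unitaryGroup_iff, star_eq_conjTranspose] at *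
  rw [controlled_conjTranspose]
  refine ext_of_mulVec_single fun k => ?_
  ext ⟨⟨c, b, i⟩, j⟩
  rw [← mulVec_mulVec, controlled_mulVec, one_mulVec]
  simp only [controlled_mulVec]
  have h2 : (if b = 1 then U else 1) * (if b = 1 then Uᴴ else 1) = 1 := by
    split_ifs <;> simp [hU]
  change ((if b = 1 then U else 1) *ᵥ ((if b = 1 then Uᴴ else 1) *ᵥ _)) (i, j) = _
  rw [mulVec_mulVec, h2, one_mulVec]

theorem Circuit.eval_append (U : Matrix (a × s) (a × s) ℂ) (k l : Circuit a s) :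
    Circuit.eval U (k ++ l) = Circuit.eval U l * Circuit.eval U k := by
  induction k with
  | nil => simp [Circuit.eval]
  | cons g k ih => simp [Circuit.eval, ih, mul_assoc]

theorem Circuit.eval_mem {U : Matrix (a × s) (a × s) ℂ} (hU : U ∈ unitaryGroup (a × s) ℂ)
    (l : Circuit a s) : Circuit.eval U l ∈ unitaryGroup (Anc a × s) ℂ := by
  induction l with
  | nil => exact one_mem _
  | cons g l ih =>
    refine mul_mem ih ?_
    cases g with
    | gate W => exact W.2
    | query => exact controlled_mem hU
    | queryInv => exact Unitary.star_mem (controlled_mem hU)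

end Gates

/-! ### The amplification circuit and its action on an eigenvector. -/

section Circuits
open Matrix ComplexConjugate Polynomial

variable {a s : Type} [Fintype a] [DecidableEq a] [Zero a] [Fintype s] [DecidableEq s]

/-- The vector `|0⟩ ⊗ v`. -/
def inj (a : Type) [DecidableEq a] [Zero a] (v : s → ℂ) : a × s → ℂ :=
  fun y => if y.1 = 0 then v y.2 else 0

/-- The vector `U† (|0⟩ ⊗ v) - t |0⟩ ⊗ v`. -/
def residue (U : Matrix (a × s) (a × s) ℂ) (v : s → ℂ) (t : ℂ) : a × s → ℂ :=
  Uᴴ *ᵥ inj a v - t • inj a v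

/-- The vector `p ⊗ |1⟩ ⊗ (|0⟩ ⊗ v) + q ⊗ |1⟩ ⊗ r`. -/
def state (v : s → ℂ) (r : a × s → ℂ) (p q : Fin 2 → ℂ) : Anc a × s → ℂ :=
  fun x => if x.1.2.1 = 1 then
    p x.1.1 * inj a v (x.1.2.2, x.2) + q x.1.1 * r (x.1.2.2, x.2) else 0

/-- A query by `U` turns the residue of `U` into that of `U†`, which is why queries must alternate
with inverse queries. The residue stays unnormalized, so `t = ±1` needs no separate case. -/
theorem controlled_mulVec_state {U : Matrix (a × s) (a × s) ℂ} (hU : U * Uᴴ = 1) (v : s → ℂ)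
    (t : ℂ) (p q : Fin 2 → ℂ) :
    controlled U *ᵥ state v (residue U v t) p q
      = state v (residue Uᴴ v t) (t • p + (1 - t ^ 2) • q) (p - t • q) := by
  ext ⟨⟨c, b, i⟩, j⟩
  rw [controlled_mulVec]
  by_cases hb : b = 1
  · subst hb
    have h1 : (fun y : a × s => state v (residue U v t) p q ((c, 1, y.1), y.2))
        = p c • inj a v + q c • residue U v t := by
      ext y; simp [state]
    have h2 : U *ᵥ residue U v t = inj a v - t • (residue Uᴴ v t + t • inj a v) := by
      simp [residue, mulVec_sub, mulVec_mulVec, hU, mulVec_smul]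
    have h3 : U *ᵥ inj a v = residue Uᴴ v t + t • inj a v := by simp [residue]
    rw [if_pos rfl, h1, mulVec_add, mulVec_smul, mulVec_smul, h2, h3]
    simp [state]
    ring
  · rw [if_neg hb, one_mulVec]
    simp [state, hb]

theorem ctrlGate_mulVec_state (V W : Matrix (Fin 2) (Fin 2) ℂ) {v : s → ℂ} {r : a × s → ℂ}
    (hr : ∀ j, r (0, j) = 0) (p q : Fin 2 → ℂ) :
    ctrlGate a s V W *ᵥ state v r p q = state v r (V *ᵥ p) (W *ᵥ q) := by
  ext ⟨⟨c, b, i⟩, j⟩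
  rw [ctrlGate_mulVec]
  by_cases hb : b = 1
  · subst hb
    by_cases hi : i = 0
    · subst hi
      simp [state, inj, hr, mulVec, dotProduct]
      ring
    · simp [state, inj, hi, mulVec, dotProduct]
      ring
  · simp [state, hb, mulVec, dotProduct]

/-- The Pauli matrix `Z`. -/
def pauliZ : Matrix (Fin 2) (Fin 2) ℂ := diagonal ![1, -1]

theorem pauliZ_mem : pauliZ ∈ unitaryGroup (Fin 2) ℂ := by
  rw [mem_unitaryGroup_iff, star_eq_conjTranspose, pauliZ, diagonal_conjTranspose,
    diagonal_mul_diagonal, ← diagonal_one]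
  congr 1
  ext i
  fin_cases i <;> simp

theorem neg_pauliZ_mem : -pauliZ ∈ unitaryGroup (Fin 2) ℂ := by
  have := pauliZ_mem
  rw [mem_unitaryGroup_iff, star_eq_conjTranspose] at *
  simpa using this

/-- Alternate queries to `controlled U` and its inverse with the rotations of a list. -/
def bodyCircuit (a s : Type) [Fintype a] [DecidableEq a] [Zero a] [Fintype s] [DecidableEq s] :
    Bool → List (unitaryGroup (Fin 2) ℂ) → Circuit a s
  | _, [] => []
  | b, V :: l => .gate ⟨ctrlGate a s 1 pauliZ, ctrlGate_mem (one_mem _) pauliZ_mem⟩ ::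
      (if b then .query else .queryInv) ::
      .gate ⟨ctrlGate a s V (V * -pauliZ), ctrlGate_mem V.2 (mul_mem V.2 neg_pauliZ_mem)⟩ ::
      bodyCircuit a s (!b) l

theorem queries_bodyCircuit (b : Bool) (l : List (unitaryGroup (Fin 2) ℂ)) :
    Circuit.queries (bodyCircuit a s b l) = l.length := by
  induction l generalizing b with
  | nil => rfl
  | cons V l ih =>
    have := ih (!b)
    cases b <;> simp_all [bodyCircuit, Circuit.queries, Step.cost, add_comm]

theorem process_smul (w : ℂ) (l : List (unitaryGroup (Fin 2) ℂ)) (r : ℂ) (A : Fin 2 → ℂ) :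
    process w l (r • A) = r • process w l A := by
  induction l generalizing A with
  | nil => rfl
  | cons V l ih =>
    change process w l _ = r • process w l _
    rw [← ih]
    simp only [mulVec_smul]

theorem residue_zero_apply {U : Matrix (a × s) (a × s) ℂ} {v : s → ℂ} {t : ℂ}
    (h : ∀ j, (Uᴴ *ᵥ inj a v) (0, j) = t * v j) (j : s) : residue U v t (0, j) = 0 := by
  simp [residue, h, inj]

/-- The state is a superposition of two eigenmodes: `p = A + B` and `(Im w) q = i (A - B)`. A query
is a reflection in the `p`, `q` coordinates; the gates `pauliZ` and `-pauliZ` on the residue part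
turn it into a rotation whose direction depends on the qubit `c`. Thus `A` undergoes `signal w` and
`B` undergoes `signal w⁻¹`. Here `W` is the operator applied by the next query. -/
theorem bodyCircuit_mulVec {v : s → ℂ} {w : ℂ} (hw : ‖w‖ = 1)
    (l : List (unitaryGroup (Fin 2) ℂ)) :
    ∀ (b : Bool) (U W : Matrix (a × s) (a × s) ℂ) (_ : W = if b then U else Uᴴ)
    (_ : U * Uᴴ = 1) (_ : Uᴴ * U = 1)
    (_ : ∀ j, (U *ᵥ inj a v) (0, j) = (w.re : ℂ) * v j)
    (_ : ∀ j, (Uᴴ *ᵥ inj a v) (0, j) = (w.re : ℂ) * v j) (A B q : Fin 2 → ℂ),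
    (w.im : ℂ) • q = Complex.I • (A - B) →
    ∃ (r : a × s → ℂ) (q' : Fin 2 → ℂ), (∀ j, r (0, j) = 0) ∧
      Circuit.eval U (bodyCircuit a s b l) *ᵥ state v (residue W v w.re) (A + B) q
        = state v r (process w l A + process w⁻¹ l B) q' := by
  induction l with
  | nil =>
    intro b U W hW _ _ h1 h2 A B q _
    refine ⟨residue W v w.re, q, residue_zero_apply ?_, ?_⟩
    · subst hW; cases b <;> simpa
    · simp [bodyCircuit, Circuit.eval, process]
  | cons V l ih =>
    intro b U W hW hU hU' h1 h2 A B q hq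
    have hWW : W * Wᴴ = 1 := by subst hW; cases b <;> simpa
    have hr1 : ∀ j, residue W v w.re (0, j) = 0 :=
      residue_zero_apply (by subst hW; cases b <;> simpa)
    have hr2 : ∀ j, residue Wᴴ v w.re (0, j) = 0 :=
      residue_zero_apply (by subst hW; cases b <;> simpa)
    have hstep : (if b then Step.query else Step.queryInv : Step a s).eval U = controlled W := by
      subst hW; cases b <;> simp [Step.eval, controlled_conjTranspose]
    have hsq : (1 - (w.re : ℂ) ^ 2) = (w.im : ℂ) ^ 2 := by
      have : w.re ^ 2 + w.im ^ 2 = 1 := by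
        have := Complex.sq_norm w
        rw [hw, Complex.normSq_apply] at this
        linarith
      rw [sub_eq_iff_eq_add', eq_comm]
      exact_mod_cast this
    have hwe : w = w.re + w.im * Complex.I := (Complex.re_add_im w).symm
    have hwi : w⁻¹ = w.re - w.im * Complex.I := by
      rw [Complex.inv_eq_conj hw]
      apply Complex.ext <;> simp
    set q₁ : Fin 2 → ℂ := pauliZ *ᵥ q
    have hq0 : (w.im : ℂ) * q 0 = Complex.I * (A 0 - B 0) := congrFun hq 0
    have hq1 : (w.im : ℂ) * q 1 = Complex.I * (A 1 - B 1) := congrFun hq 1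
    have hI := Complex.I_sq
    have hp : (w.re : ℂ) • (A + B) + (1 - (w.re : ℂ) ^ 2) • q₁ = signal w *ᵥ A + signal w⁻¹ *ᵥ B := by
      rw [hsq]
      ext i
      fin_cases i
      · simp [signal, q₁, pauliZ]
        linear_combination (w.im : ℂ) * hq0 - A 0 * hwe - B 0 * hwi
      · simp [signal, q₁, pauliZ]
        linear_combination -(w.im : ℂ) * hq1 - A 1 * hwi - B 1 * hwe
    have hqq : (w.im : ℂ) • (-pauliZ *ᵥ (A + B - (w.re : ℂ) • q₁))
        = Complex.I • (signal w *ᵥ A - signal w⁻¹ *ᵥ B) := by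
      ext i
      fin_cases i
      · simp [signal, q₁, pauliZ, vecHead, vecTail]
        linear_combination (w.re : ℂ) * hq0 - Complex.I * A 0 * hwe +
          Complex.I * B 0 * hwi - (w.im : ℂ) * (A 0 + B 0) * hI
      · simp [signal, q₁, pauliZ, vecHead, vecTail]
        linear_combination (w.re : ℂ) * hq1 - Complex.I * A 1 * hwi +
          Complex.I * B 1 * hwe + (w.im : ℂ) * (A 1 + B 1) * hI
    obtain ⟨r, q', hr, hfin⟩ := ih (!b) U Wᴴ (by subst hW; cases b <;> simp) hU hU' h1 h2
      (V.1 *ᵥ (signal w *ᵥ A)) (V.1 *ᵥ (signal w⁻¹ *ᵥ B))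
      (V.1 *ᵥ (-pauliZ *ᵥ (A + B - (w.re : ℂ) • q₁))) (by
        rw [← mulVec_smul, hqq, mulVec_smul, mulVec_sub])
    refine ⟨r, q', hr, ?_⟩
    change _ = state v r (process w l _ + process w⁻¹ l _) q'
    rw [← hfin]
    simp only [bodyCircuit, Circuit.eval, hstep]
    rw [← mulVec_mulVec, ← mulVec_mulVec, ← mulVec_mulVec]
    congr 1
    change ctrlGate a s V.1 (V.1 * -pauliZ) *ᵥ (controlled W *ᵥ (ctrlGate a s 1 pauliZ *ᵥ _)) = _
    rw [ctrlGate_mulVec_state _ _ hr1, one_mulVec, controlled_mulVec_state hWW,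
      ctrlGate_mulVec_state _ _ hr2, hp, mulVec_add, ← mulVec_mulVec]

/-- The full circuit: set the qubit `b`, rotate the qubit `c`, alternate queries and rotations, and
reset the qubit `b`. -/
def ampCircuit (a s : Type) [Fintype a] [DecidableEq a] [Zero a] [Fintype s] [DecidableEq s]
    (V₀ : unitaryGroup (Fin 2) ℂ) (l : List (unitaryGroup (Fin 2) ℂ)) : Circuit a s :=
  (.gate ⟨flipGate a s, flipGate_mem⟩ :: .gate ⟨ctrlGate a s V₀ V₀, ctrlGate_mem V₀.2 V₀.2⟩ ::
    bodyCircuit a s true l) ++ [.gate ⟨flipGate a s, flipGate_mem⟩]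

theorem queries_ampCircuit (V₀ : unitaryGroup (Fin 2) ℂ) (l : List (unitaryGroup (Fin 2) ℂ)) :
    Circuit.queries (ampCircuit a s V₀ l) = l.length := by
  rw [← queries_bodyCircuit (a := a) (s := s) true l]
  simp [ampCircuit, Circuit.queries, Step.cost]

/-- The block `(⟨0| ⊗ I) M (|0⟩ ⊗ I)`. -/
def block {m : Type} [Zero m] (M : Matrix (m × s) (m × s) ℂ) : Matrix s s ℂ :=
  M.submatrix (fun i => ((0 : m), i)) (fun j => ((0 : m), j))

theorem block_mulVec {m : Type} [Fintype m] [DecidableEq m] [Zero m]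
    (M : Matrix (m × s) (m × s) ℂ) (v : s → ℂ) (j : s) :
    (block M *ᵥ v) j = (M *ᵥ inj m v) (0, j) := by
  simp [block, inj, mulVec, dotProduct, Fintype.sum_prod_type]

theorem block_ampCircuit_mulVec {U : Matrix (a × s) (a × s) ℂ} (hU : U ∈ unitaryGroup (a × s) ℂ)
    (V₀ : unitaryGroup (Fin 2) ℂ) (l : List (unitaryGroup (Fin 2) ℂ)) {v : s → ℂ} {w : ℂ}
    (hw : ‖w‖ = 1) (h1 : block U *ᵥ v = (w.re : ℂ) • v) (h2 : (block U)ᴴ *ᵥ v = (w.re : ℂ) • v) :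
    block (Circuit.eval U (ampCircuit a s V₀ l)) *ᵥ v =
      ((process w l (V₀.1 *ᵥ ![1, 0]) 0 + process w⁻¹ l (V₀.1 *ᵥ ![1, 0]) 0) / 2) • v := by
  have hUU : U * Uᴴ = 1 := mem_unitaryGroup_iff.1 hU
  have hUU' : Uᴴ * U = 1 := mem_unitaryGroup_iff'.1 hU
  have e1 : ∀ j, (U *ᵥ inj a v) (0, j) = (w.re : ℂ) * v j := fun j => by
    rw [← block_mulVec, h1]; rfl
  have e2 : ∀ j, (Uᴴ *ᵥ inj a v) (0, j) = (w.re : ℂ) * v j := fun j => by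
    rw [← block_mulVec]
    exact congrFun h2 j
  -- The start has no residue part, so `A = B`, each half of the initial vector; this is the source
  -- of the average in the conclusion.
  set x : Fin 2 → ℂ := (1 / 2 : ℂ) • (V₀.1 *ᵥ ![1, 0])
  obtain ⟨r, q', hr, hfin⟩ := bodyCircuit_mulVec hw l true U U rfl hUU hUU' e1 e2 x x 0 (by simp)
  have hflip : flipGate a s *ᵥ inj (Anc a) v = state v (residue U v w.re) ![1, 0] 0 := by
    ext ⟨⟨c, b, i⟩, j⟩
    rw [flipGate_mulVec]
    fin_cases c <;> fin_cases b <;> simp [flipEquiv, inj, state, Prod.ext_iff]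
  have hstart : ctrlGate a s V₀.1 V₀.1 *ᵥ state v (residue U v w.re) ![1, 0] 0
      = state v (residue U v w.re) (x + x) 0 := by
    rw [ctrlGate_mulVec_state _ _ (residue_zero_apply e2), mulVec_zero]
    congr 1
    rw [← add_smul]
    norm_num
  ext j
  rw [block_mulVec, ampCircuit, Circuit.eval_append, ← mulVec_mulVec]
  simp only [Circuit.eval, Step.eval, one_mul]
  rw [← mulVec_mulVec, ← mulVec_mulVec, hflip, hstart, hfin, flipGate_mulVec]
  have hx : ∀ u, process u l x = (1 / 2 : ℂ) • process u l (V₀.1 *ᵥ ![1, 0]) :=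
    fun u => process_smul u l _ _
  rw [hx, hx]
  generalize process w l (V₀.1 *ᵥ ![1, 0]) = y
  generalize process w⁻¹ l (V₀.1 *ᵥ ![1, 0]) = z
  simp [flipEquiv, state, inj, hr]
  left
  ring

end Circuits

/-! ### Norm bounds from an eigenbasis. -/

section Spectral
open Matrix

variable {n : Type} [Fintype n] [DecidableEq n]

theorem norm_le_of_eigenvectors {H E : Matrix n n ℂ} (hH : H.IsHermitian) {μ : n → ℂ} {r : ℝ}
    (hr : 0 ≤ r) (hμ : ∀ i, ‖μ i‖ ≤ r)
    (hE : ∀ i, E *ᵥ hH.eigenvectorBasis i = μ i • ⇑(hH.eigenvectorBasis i)) : ‖E‖ ≤ r := by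
  have h : E * (hH.eigenvectorUnitary : Matrix n n ℂ) =
      (hH.eigenvectorUnitary : Matrix n n ℂ) * diagonal μ := by
    ext i j
    rw [mul_diagonal]
    have := congrFun (hE j) i
    simp only [Pi.smul_apply, smul_eq_mul] at this
    rw [IsHermitian.eigenvectorUnitary_apply, mul_comm, ← this]
    simp [mul_apply, mulVec, dotProduct, IsHermitian.eigenvectorUnitary_apply]
  rw [← CStarRing.norm_mul_coe_unitary E hH.eigenvectorUnitary, h, CStarRing.norm_coe_unitary_mul,
    l2_opNorm_diagonal]
  exact (pi_norm_le_iff_of_nonneg hr).2 hμ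

theorem abs_eigenvalues_le {H : Matrix n n ℂ} (hH : H.IsHermitian) (i : n) :
    |hH.eigenvalues i| ≤ ‖H‖ := by
  have : Nonempty n := ⟨i⟩
  have h := spectrum.norm_le_norm_of_mem (𝕜 := ℝ) (hH.eigenvalues_mem_spectrum_real i)
  simpa using h

end Spectral

/-! ### Assembly of the circuit and the error and query bounds. -/

section Amplification
open Matrix Polynomial

/-- Spectral amplification for a polynomial of the form `x κ ρ (x²)` that is bounded by `1` on
`[-1, 1]`. -/
theorem exists_circuit (a s : Type) [Fintype a] [DecidableEq a] [Zero a] [Fintype s]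
    [DecidableEq s] (ρ : ℝ[X]) (κ : ℝ) (hρ : ∀ x, |x| ≤ 1 → |x * κ * ρ.eval (x ^ 2)| < 1) :
    ∃ circ : Circuit a s, Circuit.queries circ = 2 * ρ.natDegree + 1 ∧
      ∀ U ∈ unitaryGroup (a × s) ℂ, ∀ (v : s → ℂ) (t : ℝ), |t| ≤ 1 →
        block U *ᵥ v = (t : ℂ) • v → (block U)ᴴ *ᵥ v = (t : ℂ) • v →
        block (Circuit.eval U circ) *ᵥ v = ((t * κ * ρ.eval (t ^ 2) : ℝ) : ℂ) • v := by
  obtain ⟨F, hF, hFe⟩ := exists_polynomial_sq ρ κ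
  obtain ⟨G, hG, hFG⟩ := exists_complement hF fun z hz => by
    obtain ⟨w, rfl⟩ := IsAlgClosed.exists_pow_nat_eq z two_pos
    have hw : ‖w‖ = 1 := by
      rwa [norm_pow, pow_eq_one_iff_of_nonneg (norm_nonneg w) two_ne_zero] at hz
    rw [hFe w hw, norm_mul, norm_pow, hw, one_pow, one_mul, Complex.norm_real]
    exact hρ _ (by simpa [hw] using Complex.abs_re_le_norm w)
  obtain ⟨V₀, l, hl, hp⟩ := exists_process _ F G hF hG hFG
  refine ⟨ampCircuit a s V₀ l, by rw [queries_ampCircuit, hl], fun U hU v t ht h1 h2 => ?_⟩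
  have ht2 : 0 ≤ 1 - t ^ 2 := by linarith [(sq_le_one_iff_abs_le_one t).2 ht]
  -- Both `w` and `w⁻¹` have real part `t`, so the two processed amplitudes agree and their average
  -- is the polynomial value.
  set w : ℂ := ⟨t, √(1 - t ^ 2)⟩
  have hw : ‖w‖ = 1 := by
    rw [← pow_eq_one_iff_of_nonneg (norm_nonneg w) two_ne_zero, Complex.sq_norm,
      Complex.normSq_mk, Real.mul_self_sqrt ht2]
    ring
  have hval : ∀ u : ℂ, ‖u‖ = 1 → u.re = t →
      process u l (V₀.1 *ᵥ ![1, 0]) 0 = ((t * κ * ρ.eval (t ^ 2) : ℝ) : ℂ) := fun u hu hut => by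
    have h3 := congrFun (hp u hu) 0
    simp only [Pi.smul_apply, smul_eq_mul, cons_val_zero, hFe u hu, hut] at h3
    exact mul_left_cancel₀ (pow_ne_zero _ (ne_zero_of_norm_eq_one hu)) h3
  rw [block_ampCircuit_mulVec hU V₀ l hw h1 h2, hval w hw rfl,
    hval w⁻¹ (by rw [norm_inv, hw, inv_one]) (by rw [Complex.inv_eq_conj hw]; rfl), add_self_div_two]

theorem amplification (a s : Type) [Fintype a] [DecidableEq a] [Zero a] [Fintype s]
    [DecidableEq s] {α Λ ε : ℝ} (hΛ : 0 < Λ) (hα : Λ ≤ α) (hε : 0 < ε)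
    (hε1 : ε ≤ 1 / 4 * (Λ / α)) :
    ∃ circ : Circuit a s,
      (Circuit.queries circ : ℝ) ≤ 8 * (Real.exp 10 + 2) * (α / Λ) * Real.log (1 / ε) ∧
      ∀ (H : Matrix s s ℂ) (U : Matrix (a × s) (a × s) ℂ) (d : ℕ),
        H.IsHermitian → IsStandardForm H α U d → ‖H‖ ≤ Λ →
        ∃ Hamp : Matrix s s ℂ,
          IsStandardForm Hamp (2 * Λ) (Circuit.eval U circ) (4 * d) ∧
          1 / (2 * Λ) * ‖Hamp - H‖ ≤ ε := by
  have hα0 : 0 < α := hΛ.trans_le hα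
  set δ := Λ / α
  have hδ : 0 < δ := by positivity
  have hδ1 : δ ≤ 1 := (div_le_one hα0).2 hα
  obtain ⟨ρ, hdeg, hlt, happ⟩ := exists_amplifier hδ hδ1 hε (by linarith)
  obtain ⟨circ, hq, hcirc⟩ := exists_circuit a s ρ (2 * δ)⁻¹ (by simpa only [div_eq_mul_inv] using hlt)
  simp only [← div_eq_mul_inv] at hcirc
  refine ⟨circ, ?_, fun H U d hH hU hHΛ => ?_⟩
  -- Since `ε ≤ 1/4 < 1/e`, the logarithm is at least `1` and absorbs the additive terms of `2 *
  -- ρ.natDegree + 1`.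
  · have hL : 1 ≤ Real.log (1 / ε) := by
      rw [Real.le_log_iff_exp_le (by positivity), le_div_iff₀ hε]
      nlinarith [Real.exp_one_lt_d9]
    have hδi : 1 ≤ 1 / δ := by rw [le_div_iff₀ hδ]; linarith
    have hαδ : α / Λ = 1 / δ := (one_div_div Λ α).symm
    rw [hq, hαδ]
    push_cast
    rw [div_eq_mul_one_div] at hdeg
    have h1 : 1 / δ ≤ 1 / δ * Real.log (1 / ε) := le_mul_of_one_le_right (by positivity) hL
    nlinarith
  · have hb : block U = (1 / (α : ℂ)) • H := hU.block
    have hbH : (block U)ᴴ = (1 / (α : ℂ)) • H := by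
      rw [hb, conjTranspose_smul, hH.eq]; simp
    have ht : ∀ i, |hH.eigenvalues i / α| ≤ δ := fun i => by
      rw [abs_div, abs_of_pos hα0]
      exact div_le_div_of_nonneg_right ((abs_eigenvalues_le hH i).trans hHΛ) hα0.le
    have hv : ∀ i, ((1 / (α : ℂ)) • H) *ᵥ hH.eigenvectorBasis i =
        ((hH.eigenvalues i / α : ℝ) : ℂ) • ⇑(hH.eigenvectorBasis i) := fun i => by
      rw [smul_mulVec, hH.mulVec_eigenvectorBasis]
      ext j
      simp
      ring
    set B := block (Circuit.eval U circ)
    have hB := fun i => hcirc U hU.unitary (hH.eigenvectorBasis i) _ ((ht i).trans hδ1)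
      (by rw [hb]; exact hv i) (by rw [hbH]; exact hv i)
    have hΛc : (Λ : ℂ) ≠ 0 := by exact_mod_cast hΛ.ne'
    have hαc : (α : ℂ) ≠ 0 := by exact_mod_cast hα0.ne'
    have hB1 : ‖B‖ ≤ 1 := norm_le_of_eigenvectors hH zero_le_one
      (fun i => by
        rw [Complex.norm_real]
        exact (hlt _ ((ht i).trans hδ1)).le) hB
    have hBH : ‖B - (1 / (2 * Λ : ℂ)) • H‖ ≤ ε := norm_le_of_eigenvectors hH hε.le
      (fun i => by
        have := happ _ (ht i)
        rw [← Real.norm_eq_abs, ← Complex.norm_real] at this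
        exact this)
      fun i => by
        have h1 : (1 / (2 * Λ : ℂ)) • H = (1 / (2 * δ) : ℂ) • ((1 / (α : ℂ)) • H) := by
          rw [smul_smul]
          congr 1
          simp only [δ]
          push_cast
          field_simp
        rw [sub_mulVec, hB, h1, smul_mulVec (1 / (2 * δ) : ℂ), hv, smul_smul, ← sub_smul]
        congr 1
        push_cast
        ring
    have hn : ‖(2 * Λ : ℂ)‖ = 2 * Λ := by
      rw [norm_mul, Complex.norm_real, Real.norm_eq_abs, abs_of_pos hΛ]; simp
    refine ⟨(2 * Λ : ℂ) • B, ⟨?_, by positivity, ?_, Circuit.eval_mem hU.unitary circ, ?_⟩, ?_⟩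
    · simp only [Fintype.card_prod, Fintype.card_fin, hU.card_ancilla]; ring
    · rw [norm_smul, hn]
      exact mul_le_of_le_one_right (by positivity) hB1
    · rw [smul_smul]
      push_cast
      rw [one_div_mul_cancel (by simpa using hΛc), one_smul]
      rfl
    · have h2 : (2 * Λ : ℂ) • B - H = (2 * Λ : ℂ) • (B - (1 / (2 * Λ : ℂ)) • H) := by
        rw [smul_sub, smul_smul, mul_one_div_cancel (by simpa using hΛc), one_smul]
      rw [h2, norm_smul, hn, ← mul_assoc, one_div_mul_cancel (by positivity), one_mul]
      exact hBH

end Amplification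

end SpectralAmp

theorem mainTheorem4 :
    ∃ c : ℝ, 0 < c ∧ ∃ C : ℝ, 0 < C ∧
      ∀ (n d : ℕ) [NeZero d] (α Λ ε : ℝ),
        0 < Λ → Λ ≤ α → 0 < ε → ε ≤ c * (Λ / α) →
        ∃ circ : SpectralAmp.Circuit (Fin d) (Fin n),
          (SpectralAmp.Circuit.queries circ : ℝ) ≤ C * (α / Λ) * Real.log (1 / ε) ∧
          ∀ (H : Matrix (Fin n) (Fin n) ℂ) (U : Matrix (Fin d × Fin n) (Fin d × Fin n) ℂ),
            H.IsHermitian → SpectralAmp.IsStandardForm H α U d → ‖H‖ ≤ Λ →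
            ∃ Hamp : Matrix (Fin n) (Fin n) ℂ,
              SpectralAmp.IsStandardForm Hamp (2 * Λ) (SpectralAmp.Circuit.eval U circ) (4 * d) ∧
              1 / (2 * Λ) * ‖Hamp - H‖ ≤ ε := by
  refine ⟨1 / 4, by norm_num, 8 * (Real.exp 10 + 2), by positivity, ?_⟩
  intro n d _ α Λ ε hΛ hα hε hε1
  obtain ⟨circ, hq, h⟩ := SpectralAmp.amplification (Fin d) (Fin n) hΛ hα hε hε1
  exact ⟨circ, hq, fun H U hH hU hn => h H U d hH hU hn⟩
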